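/- Let $M$ be a smooth ($C^\infty$, Hausdorff, second countable) manifold of dimension $2m$. An \emph{almost paracomplex structure} on a manifold is a smooth $(1,1)$ tensor field $J$ with $J^2=\mathrm{id}$ whose eigenbundles for the eigenvalues $+1$ and $-1$ have the same rank. It is a \emph{paracomplex structure} if it is integrable, i.e. if around every point there are smooth local coordinates $(x^1,\dots,x^k,y^1,\dots,y^k)$ with $J(\partial/\partial x^\alpha)=\partial/\partial y^\alpha$ and $J(\partial/\partial y^\alpha)=\partial/\partial x^\alpha$ for all $\alpha$. For a smooth $(1,1)$ tensor field $F$ on $M$, the \emph{complete lift} $F^c$ is the smooth $(1,1)$ tensor field on the tangent bundle $TM$ with $F^c(Z^c)=(FZ)^c$ for all smooth vector fields $Z$ on $M$. Here, in the coordinates $(z^i,z'^i)$ of $TM$ induced by coordinates $(z^i)$ of $M$, $Z^c = Z^i\,\partial/\partial z^i + \big(z'^j\,\partial Z^i/\partial z^j\big)\,\partial/\partial z'^i$ is the complete lift of $Z=Z^i\,\partial/\partial z^i$. In these coordinates $F^c$ is the block matrix $\begin{pmatrix}F&0\\ z'^j\partial_jF&F\end{pmatrix}$. \textbf{Corollary.}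 Let $J$ be a paracomplex structure on $M$. Then: (a) the complete lift $J^c$ is a paracomplex structure on $TM$ (in particular it is integrable); (b) the Nijenhuis tensor of $J^c$ vanishes: for all smooth vector fields $Z,W$ on $TM$, $$[Z,W]-J^c[J^cZ,W]-J^c[Z,J^cW]+[J^cZ,J^cW]=0;$$ (c) there is a smooth affine connection $\nabla$ on $TM$ (a covariant derivative on the tangent bundle of the manifold $TM$) which preserves $J^c$, i.e. $\nabla_X(J^cY)=J^c\nabla_XY$ for all smooth vector fields $X,Y$ on $TM$, and which is torsion-free, i.e. $\nabla_XY-\nabla_YX=[X,Y]$. -/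

import Mathlib

open Bundle
open scoped Manifold ContDiff

noncomputable section

namespace ParaLift

section Structures

variable {E : Type*} [NormedAddCommGroup E] [NormedSpace ℝ E]
  {H : Type*} [TopologicalSpace H] (I : ModelWithCorners ℝ E H)
  (M : Type*) [TopologicalSpace M] [ChartedSpace H M]

/-- A vector field on `M` (smoothness is a separate property). -/
abbrev VField := Π p : M, TangentSpace I p

/-- A tensor field of type `(1,1)` on `M`, viewed as a field of endomorphisms of the tangent
spaces (smoothness is a separate property). -/
abbrev EndField := Π p : M, TangentSpace I p →L[ℝ] TangentSpace I p

variable {I M}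

/-- The vector field `F Z`. -/
def EndField.applyField (F : EndField I M) (Z : VField I M) : VField I M :=
  fun p ↦ F p (Z p)

/-- The Nijenhuis tensor `N_J(Z, W) = [Z, W] - J[JZ, W] - J[Z, JW] + [JZ, JW]`, evaluated on
vector fields. -/
def nijenhuis (J : EndField I M) (Z W : VField I M) : VField I M := fun p ↦
  VectorField.mlieBracket I Z W p
    - J p (VectorField.mlieBracket I (J.applyField Z) W p)
    - J p (VectorField.mlieBracket I Z (J.applyField W) p)
    + VectorField.mlieBracket I (J.applyField Z) (J.applyField W) p

variable [IsManifold I ∞ M]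

/-- Smoothness of a vector field, as a section of the tangent bundle. -/
def VField.IsSmooth (Z : VField I M) : Prop :=
  ContMDiff I I.tangent ∞ (fun p : M ↦ (⟨p, Z p⟩ : TangentBundle I M))

/-- Smoothness of a `(1,1)` tensor field, as a section of the bundle `Hom(TM, TM)`. -/
def EndField.IsSmooth (F : EndField I M) : Prop :=
  ContMDiff I (I.prod 𝓘(ℝ, E →L[ℝ] E)) ∞ (fun p : M ↦
    (⟨p, F p⟩ : TotalSpace (E →L[ℝ] E) (fun p : M ↦ TangentSpace I p →L[ℝ] TangentSpace I p)))

/-- An almost paracomplex structure: a smooth `(1,1)` tensor field `J` with `J² = id` whose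
eigenbundles for the eigenvalues `1` and `-1` have the same rank. -/
structure IsAlmostParacomplex (J : EndField I M) : Prop where
  smooth : J.IsSmooth
  sq : ∀ (p : M) (v : TangentSpace I p), J p (J p v) = v
  rank_eq : ∀ p : M,
    Module.finrank ℝ (Module.End.eigenspace (J p : Module.End ℝ (TangentSpace I p)) 1) =
      Module.finrank ℝ (Module.End.eigenspace (J p : Module.End ℝ (TangentSpace I p)) (-1))

/-- A paracomplex structure: an almost paracomplex structure which is integrable as a
`G`-structure. Around every point there are smooth local coordinates
`(x¹, …, xᵐ, y¹, …, yᵐ) = L ∘ φ` in which `J (∂/∂xᵅ) = ∂/∂yᵅ` and `J (∂/∂yᵅ) = ∂/∂xᵅ`,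
that is, in which `J` exchanges the `x`-components and the `y`-components of a tangent vector. -/
structure IsParacomplex (J : EndField I M) : Prop extends IsAlmostParacomplex J where
  integrable : ∀ p : M, ∃ φ ∈ IsManifold.maximalAtlas I ∞ M, p ∈ φ.source ∧
    ∃ (m : ℕ) (L : E ≃L[ℝ] (Fin m → ℝ) × (Fin m → ℝ)),
      ∀ q ∈ φ.source, ∀ v : TangentSpace I q,
        L (mfderiv I 𝓘(ℝ, E) (φ.extend I) q (J q v)) =
          (L (mfderiv I 𝓘(ℝ, E) (φ.extend I) q v)).swap

end Structures

section Lifts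

variable {E : Type*} [NormedAddCommGroup E] [NormedSpace ℝ E]
  {H : Type*} [TopologicalSpace H] {I : ModelWithCorners ℝ E H}
  {M : Type*} [TopologicalSpace M] [ChartedSpace H M] [IsManifold I ∞ M]

/-- The components of the vector field `Z` at points `p'` near `p`, in the coordinates given by
the preferred chart at `p`. -/
def VField.coord (Z : VField I M) (p p' : M) : E :=
  (trivializationAt E (TangentSpace I : M → Type _) p).continuousLinearMapAt ℝ p' (Z p')

/-- The matrix of the tensor field `F` at points `p'` near `p`, in the coordinates given by the
preferred chart at `p`. -/
def EndField.coord (F : EndField I M) (p p' : M) : E →L[ℝ] E :=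
  ContinuousLinearMap.inCoordinates E (TangentSpace I : M → Type _) E
    (TangentSpace I : M → Type _) p p' p p' (F p')

/-- The complete lift `Z^c` of a vector field to the tangent bundle. At a point `(p, v)` of `TM`,
the tangent space to `TM` is `E × E` through the coordinates `(z, z')` of `TM` induced by the
preferred chart at `p`, and `Z^c` has the components `((Zᵅ)^v, (Zᵅ)^c)`, where `f^v (p, v) = f p`
and `f^c (p, v) = df_p(v)` are the vertical and complete lifts of functions. -/
def VField.completeLift (Z : VField I M) : VField I.tangent (TangentBundle I M) :=
  fun q ↦ ((Z q.proj : E), (mfderiv I 𝓘(ℝ, E) (Z.coord q.proj) q.proj q.snd : E))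

/-- The complete lift `F^c` of a `(1,1)` tensor field to the tangent bundle. In the coordinates
`(z, z')` of `TM` induced by the preferred chart at the base point it is the block matrix
with rows `(F^v, 0)` and `(F^c, F^v)`, where the vertical and complete lifts of the matrix of `F`
are taken entrywise. -/
def EndField.completeLift (F : EndField I M) : EndField I.tangent (TangentBundle I M) :=
  fun q ↦
    let A : E →L[ℝ] E := F q.proj
    let B : E →L[ℝ] E :=
      mfderiv I 𝓘(ℝ, E →L[ℝ] E) (F.coord q.proj) q.proj q.snd
    (A.comp (ContinuousLinearMap.fst ℝ E E)).prod
      (B.comp (ContinuousLinearMap.fst ℝ E E) + A.comp (ContinuousLinearMap.snd ℝ E E))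

/-- At the base point itself the components are those of the vector. -/
theorem VField.coord_self (Z : VField I M) (p : M) : Z.coord p p = (Z p : E) := by
  have h := TangentBundle.continuousLinearMapAt_trivializationAt_eq_core (I := I)
    (mem_chart_source H p)
  unfold VField.coord
  rw [h]
  exact (tangentBundleCore I M).coordChange_self _ _ (mem_chart_source H p) _

/-- At the base point itself the matrix is that of the endomorphism. -/
theorem EndField.coord_self (F : EndField I M) (p : M) : F.coord p p = (F p : E →L[ℝ] E) := by
  have h := TangentBundle.continuousLinearMapAt_trivializationAt_eq_core (I := I)
    (mem_chart_source H p)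
  have h' := TangentBundle.symmL_trivializationAt_eq_core (I := I) (mem_chart_source H p)
  ext w
  unfold EndField.coord ContinuousLinearMap.inCoordinates
  rw [h, h']
  refine ((tangentBundleCore I M).coordChange_self _ _ (mem_chart_source H p) _).trans ?_
  exact congrArg (F p) ((tangentBundleCore I M).coordChange_self _ _ (mem_chart_source H p) _)

/-- The complete lift of a tensor field satisfies `F^c (Z^c) = (F Z)^c` for every vector
field `Z`. -/
theorem EndField.completeLift_apply (F : EndField I M) (hF : F.IsSmooth) (Z : VField I M)
    (hZ : Z.IsSmooth) :
    F.completeLift.applyField Z.completeLift = (F.applyField Z).completeLift := by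
  funext q
  obtain ⟨p, v⟩ := q
  have hF' : MDifferentiableAt I 𝓘(ℝ, E →L[ℝ] E) (F.coord p) p :=
    ((mdifferentiableAt_hom_bundle _).1 ((hF p).mdifferentiableAt (by simp))).2
  have hZ' : MDifferentiableAt I 𝓘(ℝ, E) (Z.coord p) p := by
    have := (mdifferentiableAt_section _ _).1 ((hZ p).mdifferentiableAt (by simp))
    refine this.congr_of_eventuallyEq ?_
    filter_upwards [(trivializationAt E (TangentSpace I : M → Type _) p).open_baseSet.mem_nhds
      (FiberBundle.mem_baseSet_trivializationAt' p)] with x hx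
    exact (trivializationAt E (TangentSpace I : M → Type _) p).continuousLinearMapAt_apply_of_mem
      (R := ℝ) hx _
  have hpair : HasMFDerivAt I 𝓘(ℝ, (E →L[ℝ] E) × E) (fun x ↦ (F.coord p x, Z.coord p x)) p
      ((mfderiv I 𝓘(ℝ, E →L[ℝ] E) (F.coord p) p).prod (mfderiv I 𝓘(ℝ, E) (Z.coord p) p)) :=
    ⟨hF'.hasMFDerivAt.1.prodMk hZ'.hasMFDerivAt.1, hF'.hasMFDerivAt.2.prodMk hZ'.hasMFDerivAt.2⟩
  have hd : HasMFDerivAt I 𝓘(ℝ, E) (fun x ↦ F.coord p x (Z.coord p x)) p _ :=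
    (((isBoundedBilinearMap_apply (𝕜 := ℝ) (E := E) (F := E)).hasFDerivAt
      (F.coord p p, Z.coord p p)).hasMFDerivAt).comp p hpair
  have hFZ : (F.applyField Z).coord p =ᶠ[nhds p] fun x ↦ F.coord p x (Z.coord p x) := by
    filter_upwards [(trivializationAt E (TangentSpace I : M → Type _) p).open_baseSet.mem_nhds
      (FiberBundle.mem_baseSet_trivializationAt' p)] with x hx
    simp only [VField.coord, EndField.coord, EndField.applyField,
      ContinuousLinearMap.inCoordinates, ContinuousLinearMap.comp_apply]
    rw [Bundle.Trivialization.symmL_continuousLinearMapAt _ hx]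
  have key : mfderiv I 𝓘(ℝ, E) ((F.applyField Z).coord p) p = _ :=
    (hd.congr_of_eventuallyEq hFZ).mfderiv
  refine Prod.ext rfl ?_
  have k := congrArg (fun T : E →L[ℝ] E ↦ T v) key
  refine Eq.trans ?_ k.symm
  let B : E →L[ℝ] E := mfderiv I 𝓘(ℝ, E →L[ℝ] E) (F.coord p) p v
  let u : E := mfderiv I 𝓘(ℝ, E) (Z.coord p) p v
  let A : E →L[ℝ] E := F p
  let z : E := Z p
  have hA : F.coord p p = A := F.coord_self p
  have hz : Z.coord p p = z := Z.coord_self p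
  change B z + A u = F.coord p p u + B (Z.coord p p)
  rw [hA, hz, add_comm]

/-- An affine connection on `M`, i.e. a covariant derivative on `TM`, preserves the tensor field
`J`, i.e. `∇ J = 0`: one has `∇_X (J Y) = J (∇_X Y)` for all vector fields `X`, `Y`. -/
def Preserves (cov : CovariantDerivative I E (TangentSpace I : M → Type _))
    (J : EndField I M) : Prop :=
  ∀ (Y : VField I M), Y.IsSmooth → ∀ (p : M) (X : TangentSpace I p),
    cov (J.applyField Y) p X = J p (cov Y p X)

end Lifts

end ParaLift

end

open ParaLift

noncomputable section

namespace ParaLift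

open Filter VectorField
open scoped Topology

section Charts

variable {E : Type*} [NormedAddCommGroup E] [NormedSpace ℝ E]
  {H : Type*} [TopologicalSpace H] {I : ModelWithCorners ℝ E H}
  {M : Type*} [TopologicalSpace M] [ChartedSpace H M]

/-- The derivative of a chart, as a linear map from the tangent space to the model space. -/
def chartDeriv (I : ModelWithCorners ℝ E H) (φ : OpenPartialHomeomorph M H) (x : M) :
    TangentSpace I x →L[ℝ] E :=
  mfderiv I 𝓘(ℝ, E) (φ.extend I) x

theorem mdifferentiable_of_mem_maximalAtlas {φ : OpenPartialHomeomorph M H}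
    (hφ : φ ∈ IsManifold.maximalAtlas I ∞ M) : φ.MDifferentiable I I :=
  ⟨(contMDiffOn_of_mem_maximalAtlas hφ).mdifferentiableOn (by simp),
    (contMDiffOn_symm_of_mem_maximalAtlas hφ).mdifferentiableOn (by simp)⟩

theorem chartDeriv_eq_mfderiv {φ : OpenPartialHomeomorph M H}
    (hφ : φ ∈ IsManifold.maximalAtlas I ∞ M) {x : M} (hx : x ∈ φ.source) :
    chartDeriv I φ x = mfderiv I I φ x := by
  have h := (mdifferentiable_of_mem_maximalAtlas hφ).mdifferentiableAt hx
  have := (I.hasMFDerivAt (x := φ x)).comp x h.hasMFDerivAt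
  exact this.mfderiv

/-- The derivative of a chart, as an equivalence. -/
theorem chartDeriv_exists_equiv {φ : OpenPartialHomeomorph M H}
    (hφ : φ ∈ IsManifold.maximalAtlas I ∞ M) {x : M} (hx : x ∈ φ.source) :
    ∃ e : TangentSpace I x ≃L[ℝ] E, chartDeriv I φ x = e :=
  ⟨(mdifferentiable_of_mem_maximalAtlas hφ).mfderiv hx, chartDeriv_eq_mfderiv hφ hx⟩

variable [IsManifold I ∞ M]

variable {F : Type*} [NormedAddCommGroup F] [NormedSpace ℝ F]

/-- The derivative of a smooth function is smooth in the coordinates of a preferred chart. -/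
theorem contMDiffAt_mfderiv_comp_symmL {f : M → F} {x : M} (hf : ContMDiffAt I 𝓘(ℝ, F) ∞ f x) :
    ContMDiffAt I 𝓘(ℝ, E →L[ℝ] F) ∞ (fun y ↦
      (show TangentSpace I y →L[ℝ] F from mfderiv I 𝓘(ℝ, F) f y) ∘L
        (trivializationAt E (TangentSpace I : M → Type _) x).symmL ℝ y) x := by
  have := hf.mfderiv_const (m := ∞) (by simp)
  refine this.congr_of_eventuallyEq ?_
  filter_upwards with y
  simp only [inTangentCoordinates, ContinuousLinearMap.inCoordinates,
    TangentBundle.continuousLinearMapAt_model_space]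
  rfl

theorem chartDeriv_symmL_contMDiffAt {φ : OpenPartialHomeomorph M H}
    (hφ : φ ∈ IsManifold.maximalAtlas I ∞ M) {x : M} (hx : x ∈ φ.source) :
    ContMDiffAt I 𝓘(ℝ, E →L[ℝ] E) ∞ (fun y ↦ chartDeriv I φ y ∘L
        (trivializationAt E (TangentSpace I : M → Type _) x).symmL ℝ y) x :=
  contMDiffAt_mfderiv_comp_symmL (φ.contMDiffAt_extend hφ hx)

theorem eventually_mem_baseSet (x : M) : ∀ᶠ y in 𝓝 x,
    y ∈ (trivializationAt E (TangentSpace I : M → Type _) x).baseSet :=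
  (trivializationAt E (TangentSpace I : M → Type _) x).open_baseSet.mem_nhds
      (FiberBundle.mem_baseSet_trivializationAt' x)

theorem chartDeriv_apply_eventuallyEq (φ : OpenPartialHomeomorph M H) (X : VField I M) (x : M) :
    (fun y ↦ chartDeriv I φ y (X y)) =ᶠ[𝓝 x] fun y ↦ (chartDeriv I φ y ∘L
        (trivializationAt E (TangentSpace I : M → Type _) x).symmL ℝ y)
          ((trivializationAt E (TangentSpace I : M → Type _) x) ⟨y, X y⟩).2 := by
  filter_upwards [eventually_mem_baseSet (I := I) x] with y hy
  rw [ContinuousLinearMap.comp_apply,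
    ← Trivialization.continuousLinearMapAt_apply_of_mem (R := ℝ) _ hy,
    Trivialization.symmL_continuousLinearMapAt _ hy]

theorem chartDeriv_apply_mdifferentiableAt {φ : OpenPartialHomeomorph M H}
    (hφ : φ ∈ IsManifold.maximalAtlas I ∞ M) {x : M} (hx : x ∈ φ.source) {X : VField I M}
    (hX : MDifferentiableAt I I.tangent (fun y ↦ (⟨y, X y⟩ : TangentBundle I M)) x) :
    MDifferentiableAt I 𝓘(ℝ, E) (fun y ↦ chartDeriv I φ y (X y)) x := by
  refine MDifferentiableAt.congr_of_eventuallyEq ?_ (chartDeriv_apply_eventuallyEq φ X x)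
  exact ((chartDeriv_symmL_contMDiffAt hφ hx).mdifferentiableAt (by simp)).clm_apply
    ((mdifferentiableAt_section _ _).1 hX)

theorem chartDeriv_apply_contMDiffAt {φ : OpenPartialHomeomorph M H}
    (hφ : φ ∈ IsManifold.maximalAtlas I ∞ M) {x : M} (hx : x ∈ φ.source) {X : VField I M}
    (hX : ContMDiffAt I I.tangent ∞ (fun y ↦ (⟨y, X y⟩ : TangentBundle I M)) x) :
    ContMDiffAt I 𝓘(ℝ, E) ∞ (fun y ↦ chartDeriv I φ y (X y)) x := by
  refine ContMDiffAt.congr_of_eventuallyEq ?_ (chartDeriv_apply_eventuallyEq φ X x)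
  exact (chartDeriv_symmL_contMDiffAt hφ hx).clm_apply
    ((contMDiffAt_section _).1 hX)

/-- If `A` is a smooth one-form with values in the model space, then `D⁻¹ A` is a smooth
endomorphism field, where `D` is the derivative of a chart. -/
theorem contMDiffAt_chartDeriv_inverse_comp [CompleteSpace E] {φ : OpenPartialHomeomorph M H}
    (hφ : φ ∈ IsManifold.maximalAtlas I ∞ M) {x : M} (hx : x ∈ φ.source)
    {A : Π y : M, TangentSpace I y →L[ℝ] E}
    (hA : ContMDiffAt I 𝓘(ℝ, E →L[ℝ] E) ∞ (fun y ↦ A y ∘L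
        (trivializationAt E (TangentSpace I : M → Type _) x).symmL ℝ y) x) :
    ContMDiffAt I (I.prod 𝓘(ℝ, E →L[ℝ] E)) ∞ (fun y : M ↦
      (⟨y, (chartDeriv I φ y).inverse ∘L A y⟩ :
        TotalSpace (E →L[ℝ] E) (fun p : M ↦ TangentSpace I p →L[ℝ] TangentSpace I p))) x := by
  rw [contMDiffAt_hom_bundle]
  refine ⟨contMDiffAt_id, ?_⟩
  set e := trivializationAt E (TangentSpace I : M → Type _) x with he
  have hinv : ∀ y ∈ φ.source, y ∈ e.baseSet →
      (chartDeriv I φ y ∘L e.symmL ℝ y).IsInvertible ∧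
      (chartDeriv I φ y ∘L e.symmL ℝ y).inverse =
        e.continuousLinearMapAt ℝ y ∘L (chartDeriv I φ y).inverse := by
    intro y hy hy'
    obtain ⟨d, hd⟩ := chartDeriv_exists_equiv hφ hy
    have h1 : chartDeriv I φ y ∘L e.symmL ℝ y =
        (((e.continuousLinearEquivAt ℝ y hy').symm.trans d : E ≃L[ℝ] E) : E →L[ℝ] E) := by
      rw [hd]
      ext v
      simp [Trivialization.symm_continuousLinearEquivAt_eq _ hy']
    refine ⟨⟨_, h1.symm⟩, ?_⟩
    rw [h1, hd, ContinuousLinearMap.inverse_equiv, ContinuousLinearMap.inverse_equiv]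
    ext v
    simp [Trivialization.continuousLinearMapAt_apply, Trivialization.linearMapAt_apply, hy']
  have hbase := FiberBundle.mem_baseSet_trivializationAt' (F := E)
    (E := (TangentSpace I : M → Type _)) x
  have h1 : ContMDiffAt I 𝓘(ℝ, E →L[ℝ] E) ∞ (fun y ↦
      (chartDeriv I φ y ∘L e.symmL ℝ y).inverse) x := by
    have := ((hinv x hx hbase).1.contDiffAt_map_inverse (n := ∞)).contMDiffAt
    exact this.comp x (chartDeriv_symmL_contMDiffAt hφ hx)
  refine (h1.clm_comp hA).congr_of_eventuallyEq ?_
  filter_upwards [φ.open_source.mem_nhds hx, eventually_mem_baseSet (I := I) x] with y hy hy'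
  rw [(hinv y hy hy').2]
  rfl

end Charts

section Connection

variable {E : Type*} [NormedAddCommGroup E] [NormedSpace ℝ E]
  {H : Type*} [TopologicalSpace H] {I : ModelWithCorners ℝ E H}
  {M : Type*} [TopologicalSpace M] [ChartedSpace H M]

/-- The flat connection of a chart. -/
def chartConnection (I : ModelWithCorners ℝ E H) (φ : OpenPartialHomeomorph M H) (X : VField I M)
    (x : M) : TangentSpace I x →L[ℝ] TangentSpace I x :=
  (chartDeriv I φ x).inverse ∘L mvfderiv I (fun y ↦ chartDeriv I φ y (X y)) x

theorem chartDeriv_inverse_apply_self {φ : OpenPartialHomeomorph M H}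
    (hφ : φ ∈ IsManifold.maximalAtlas I ∞ M) {x : M} (hx : x ∈ φ.source) (v : TangentSpace I x) :
    (chartDeriv I φ x).inverse (chartDeriv I φ x v) = v := by
  obtain ⟨e, he⟩ := chartDeriv_exists_equiv hφ hx
  simp [he]

theorem chartDeriv_inverse_self_apply {φ : OpenPartialHomeomorph M H}
    (hφ : φ ∈ IsManifold.maximalAtlas I ∞ M) {x : M} (hx : x ∈ φ.source) (v : E) :
    chartDeriv I φ x ((chartDeriv I φ x).inverse v) = v := by
  obtain ⟨e, he⟩ := chartDeriv_exists_equiv hφ hx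
  simp [he]

variable [IsManifold I ∞ M]

theorem chartConnection_isCovariantDerivativeOn {φ : OpenPartialHomeomorph M H}
    (hφ : φ ∈ IsManifold.maximalAtlas I ∞ M) :
    IsCovariantDerivativeOn E (chartConnection I φ) φ.source where
  add {X Y x} hX hY hx := by
    have h : (fun y ↦ chartDeriv I φ y ((X + Y) y)) =
      (fun y ↦ chartDeriv I φ y (X y)) + fun y ↦ chartDeriv I φ y (Y y) := by
      ext y
      simp
    unfold chartConnection
    rw [h, mvfderiv_add (chartDeriv_apply_mdifferentiableAt hφ hx hX)
      (chartDeriv_apply_mdifferentiableAt hφ hx hY), ContinuousLinearMap.comp_add]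
  leibniz {X g x} hX hg hx := by
    have h : (fun y ↦ chartDeriv I φ y ((g • X) y)) =
      g • (fun y ↦ chartDeriv I φ y (X y)) := by
      ext y
      simp
    unfold chartConnection
    rw [h, mvfderiv_smul hg (chartDeriv_apply_mdifferentiableAt hφ hx hX)]
    ext v
    simp [chartDeriv_inverse_apply_self hφ hx]

theorem chartConnection_contMDiffAt [CompleteSpace E] {φ : OpenPartialHomeomorph M H}
    (hφ : φ ∈ IsManifold.maximalAtlas I ∞ M) {x : M} (hx : x ∈ φ.source) {X : VField I M}
    (hX : ContMDiffAt I I.tangent ∞ (fun y ↦ (⟨y, X y⟩ : TangentBundle I M)) x) :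
    ContMDiffAt I (I.prod 𝓘(ℝ, E →L[ℝ] E)) ∞ (fun y : M ↦
      (⟨y, chartConnection I φ X y⟩ :
        TotalSpace (E →L[ℝ] E) (fun p : M ↦ TangentSpace I p →L[ℝ] TangentSpace I p))) x :=
  contMDiffAt_chartDeriv_inverse_comp hφ hx
    (contMDiffAt_mfderiv_comp_symmL (chartDeriv_apply_contMDiffAt hφ hx hX))

theorem chartConnection_applyField {φ : OpenPartialHomeomorph M H}
    (hφ : φ ∈ IsManifold.maximalAtlas I ∞ M) {x : M} (hx : x ∈ φ.source) {J : EndField I M}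
    {S : E →L[ℝ] E} (hJ : ∀ y ∈ φ.source, ∀ v, chartDeriv I φ y (J y v) = S (chartDeriv I φ y v))
    {X : VField I M}
    (hX : MDifferentiableAt I I.tangent (fun y ↦ (⟨y, X y⟩ : TangentBundle I M)) x)
    (v : TangentSpace I x) :
    chartConnection I φ (J.applyField X) x v = J x (chartConnection I φ X x v) := by
  have h1 := (chartDeriv_apply_mdifferentiableAt hφ hx hX).hasMFDerivAt
  have h2 := (S.hasMFDerivAt.comp x h1).congr_of_eventuallyEq
    (f₁ := fun y ↦ chartDeriv I φ y (J.applyField X y)) (by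
      filter_upwards [φ.open_source.mem_nhds hx] with y hy using hJ y hy _)
  have key := hJ x hx (chartConnection I φ X x v)
  rw [← chartDeriv_inverse_apply_self hφ hx (J x _)]
  refine congrArg (chartDeriv I φ x).inverse ?_
  refine (congrArg (fun T : TangentSpace I x →L[ℝ] E ↦ T v) h2.mfderiv).trans ?_
  refine Eq.trans ?_ key.symm
  exact (congrArg S (chartDeriv_inverse_self_apply hφ hx _)).symm

omit [IsManifold I ∞ M] in
theorem mlieBracket_eq_lieBracket {V W : Π x : E, TangentSpace 𝓘(ℝ, E) x} :
    mlieBracket 𝓘(ℝ, E) V W = lieBracket ℝ V W := by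
  rw [← mlieBracketWithin_univ, mlieBracketWithin_eq_lieBracketWithin]
  exact lieBracketWithin_univ

omit [IsManifold I ∞ M] in
theorem mdifferentiableAt_vectorField {V : E → E} {u : E} (hV : DifferentiableAt ℝ V u) :
    MDifferentiableAt 𝓘(ℝ, E) 𝓘(ℝ, E).tangent
      (fun y ↦ (⟨y, V y⟩ : TangentBundle 𝓘(ℝ, E) E)) u := by
  refine (mdifferentiableAt_totalSpace _ _).2 ⟨mdifferentiableAt_id, ?_⟩
  convert! hV.mdifferentiableAt with y
  simp

theorem chartConnection_torsion [CompleteSpace E] [I.Boundaryless] {φ : OpenPartialHomeomorph M H}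
    (hφ : φ ∈ IsManifold.maximalAtlas I ∞ M) {x : M} (hx : x ∈ φ.source)
    {X Y : VField I M}
    (hX : MDifferentiableAt I I.tangent (fun y ↦ (⟨y, X y⟩ : TangentBundle I M)) x)
    (hY : MDifferentiableAt I I.tangent (fun y ↦ (⟨y, Y y⟩ : TangentBundle I M)) x) :
    chartConnection I φ Y x (X x) - chartConnection I φ X x (Y x) = mlieBracket I X Y x := by
  set f := φ.extend I with hf
  have hfx : x ∈ f.source := by simpa [hf] using hx
  have hf' : ContMDiffAt I 𝓘(ℝ, E) ∞ f x := φ.contMDiffAt_extend hφ hx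
  have hsymm : MDifferentiableAt 𝓘(ℝ, E) I f.symm (f x) := by
    have h := contMDiffOn_extend_symm hφ
    have : I '' φ.target ∈ 𝓝 (f x) :=
      (I.toHomeomorph.isOpenMap _ φ.open_target).mem_nhds ⟨φ x, φ.map_source hx, rfl⟩
    exact (h.contMDiffAt this).mdifferentiableAt (by simp)
  have hnhds : ∀ᶠ y in 𝓝 x, y ∈ φ.source := φ.open_source.mem_nhds hx
  have push : ∀ Z : VField I M,
      MDifferentiableAt I I.tangent (fun y ↦ (⟨y, Z y⟩ : TangentBundle I M)) x →
      ∃ V : E → E, DifferentiableAt ℝ V (f x) ∧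
        mpullback I 𝓘(ℝ, E) f V =ᶠ[𝓝 x] Z ∧ V (f x) = chartDeriv I φ x (Z x) ∧
        ∀ v, fderiv ℝ V (f x) (chartDeriv I φ x v) =
          chartDeriv I φ x (chartConnection I φ Z x v) := by
    intro Z hZ
    have hg := chartDeriv_apply_mdifferentiableAt hφ hx hZ
    set g : M → E := fun y ↦ chartDeriv I φ y (Z y) with hgdef
    have hV : MDifferentiableAt 𝓘(ℝ, E) 𝓘(ℝ, E) (g ∘ f.symm) (f x) := by
      refine MDifferentiableAt.comp (f x) (I' := I) ?_ hsymm
      rwa [f.left_inv hfx]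
    have hVg : (g ∘ f.symm) ∘ f =ᶠ[𝓝 x] g := by
      filter_upwards [hnhds] with y hy
      have : y ∈ f.source := by simpa [hf] using hy
      simp [f.left_inv this]
    refine ⟨g ∘ f.symm, hV.differentiableAt, ?_, ?_, ?_⟩
    · filter_upwards [hnhds, hVg] with y hy hy'
      refine Eq.trans ?_ (chartDeriv_inverse_apply_self hφ hy (Z y))
      exact congrArg (chartDeriv I φ y).inverse hy'
    · exact congrArg g (f.left_inv hfx)
    · intro v
      have h1 := hV.hasMFDerivAt.comp x (hf'.mdifferentiableAt (by simp)).hasMFDerivAt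
      have h2 := (h1.congr_of_eventuallyEq hVg.symm).mfderiv
      rw [mfderiv_eq_fderiv] at h2
      refine (congrArg (fun T : E →L[ℝ] E ↦ T v) h2).symm.trans ?_
      exact (chartDeriv_inverse_self_apply hφ hx _).symm
  obtain ⟨V, hV, hVX, hV1, hV2⟩ := push X hX
  obtain ⟨W, hW, hWY, hW1, hW2⟩ := push Y hY
  rw [← hVX.mlieBracket_vectorField_eq hWY]
  have : IsManifold I (minSmoothness ℝ 2) M := by
    rw [minSmoothness_of_isRCLikeNormedField]
    infer_instance
  have hb := mpullback_mlieBracket (I := I) (I' := 𝓘(ℝ, E)) (f := f) (V := V) (W := W) (x₀ := x)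
    (n := ∞) (mdifferentiableAt_vectorField hV) (mdifferentiableAt_vectorField hW)
    hf' (by rw [minSmoothness_of_isRCLikeNormedField]; exact ENat.LEInfty.out)
  rw [← hb, mpullback_apply, ← chartDeriv_inverse_apply_self hφ hx (_ - _)]
  refine congrArg (chartDeriv I φ x).inverse ?_
  refine Eq.trans ?_ (congrFun (mlieBracket_eq_lieBracket (V := V) (W := W)) (f x)).symm
  rw [map_sub, ← hV2, ← hW2, lieBracket, hV1, hW1]

end Connection

section Glue

variable {E : Type*} [NormedAddCommGroup E] [NormedSpace ℝ E]
  {H : Type*} [TopologicalSpace H] {I : ModelWithCorners ℝ E H}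
  {M : Type*} [TopologicalSpace M] [ChartedSpace H M] [IsManifold I ∞ M]
  {ι : Type*} {ρ : ι → M → ℝ} {φ : ι → OpenPartialHomeomorph M H}

/-- The sum of the flat connections of charts, weighted by a partition of unity, as a function on
vector fields. -/
def gluedConnectionFun (I : ModelWithCorners ℝ E H) (ρ : ι → M → ℝ)
    (φ : ι → OpenPartialHomeomorph M H) (X : VField I M)
    (x : M) : TangentSpace I x →L[ℝ] TangentSpace I x :=
  ∑ᶠ i, ρ i x • chartConnection I (φ i) X x

omit [IsManifold I ∞ M] in
/-- At a point, the glued connection is a finite convex combination of flat connections of charts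
around the point. -/
theorem gluedConnectionFun_exists_finset (hfin : LocallyFinite fun i ↦ Function.support (ρ i))
    (hsum : ∀ x, ∑ᶠ i, ρ i x = 1) (hsub : ∀ i, tsupport (ρ i) ⊆ (φ i).source) (x : M) :
    ∃ s : Finset ι, (∀ i ∈ s, x ∈ (φ i).source) ∧ ∑ i ∈ s, ρ i x = 1 ∧
      ∀ X, gluedConnectionFun I ρ φ X x = ∑ i ∈ s, ρ i x • chartConnection I (φ i) X x := by
  have hf := hfin.point_finite x
  refine ⟨hf.toFinset, ?_, ?_, ?_⟩
  · intro i hi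
    exact hsub i (subset_tsupport _ (by simpa using hi))
  · rw [← hsum x]
    refine (finsum_eq_sum_of_support_subset _ ?_).symm
    intro i hi
    simpa using hi
  · intro X
    refine finsum_eq_sum_of_support_subset _ ?_
    intro i hi
    simp only [Function.mem_support] at hi
    have : ρ i x ≠ 0 := fun h ↦ hi (by rw [h, zero_smul])
    simpa using this

/-- The connection obtained by gluing the flat connections of charts with a partition of unity. -/
def gluedConnection (hfin : LocallyFinite fun i ↦ Function.support (ρ i))
    (hsum : ∀ x, ∑ᶠ i, ρ i x = 1) (hsub : ∀ i, tsupport (ρ i) ⊆ (φ i).source)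
    (hφ : ∀ i, φ i ∈ IsManifold.maximalAtlas I ∞ M) :
    CovariantDerivative I E (TangentSpace I : M → Type _) where
  toFun := gluedConnectionFun I ρ φ
  isCovariantDerivativeOnUniv :=
    { add := fun {X Y x} hX hY _ ↦ by
        obtain ⟨s, hs, -, h⟩ := gluedConnectionFun_exists_finset (I := I) hfin hsum hsub x
        rw [h, h, h, ← Finset.sum_add_distrib]
        refine Finset.sum_congr rfl fun i hi ↦ ?_
        rw [(chartConnection_isCovariantDerivativeOn (hφ i)).add hX hY (hs i hi), smul_add]
      leibniz := fun {X g x} hX hg _ ↦ by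
        obtain ⟨s, hs, h1, h⟩ := gluedConnectionFun_exists_finset (I := I) hfin hsum hsub x
        rw [h, h, Finset.smul_sum, ← one_smul ℝ ((mvfderiv I g x).smulRight (X x)), ← h1,
          Finset.sum_smul, ← Finset.sum_add_distrib]
        refine Finset.sum_congr rfl fun i hi ↦ ?_
        rw [(chartConnection_isCovariantDerivativeOn (hφ i)).leibniz hX hg (hs i hi), smul_add,
          smul_comm] }

variable (hfin : LocallyFinite fun i ↦ Function.support (ρ i))
  (hsum : ∀ x, ∑ᶠ i, ρ i x = 1) (hsub : ∀ i, tsupport (ρ i) ⊆ (φ i).source)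
  (hφ : ∀ i, φ i ∈ IsManifold.maximalAtlas I ∞ M)

theorem gluedConnection_contMDiff [CompleteSpace E] (hρ : ∀ i, ContMDiff I 𝓘(ℝ) ∞ (ρ i)) :
    CovariantDerivative.ContMDiffCovariantDerivative (gluedConnection hfin hsum hsub hφ) ∞ := by
  refine ⟨⟨fun {X} hX ↦ ?_⟩⟩
  have hX' : ∀ x, ContMDiffAt I I.tangent ∞ (fun y ↦ (⟨y, X y⟩ : TangentBundle I M)) x := by
    intro x
    exact (contMDiffOn_univ.1 hX) x
  refine contMDiffOn_univ.2 fun x ↦ ?_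
  refine ContMDiffAt.finsum_section_of_locallyFinite ?_ fun i ↦ ?_
  · refine hfin.subset fun i y hy hy' ↦ hy ?_
    simp [hy']
  · by_cases hx : x ∈ tsupport (ρ i)
    · exact (hρ i x).smul_section (chartConnection_contMDiffAt (hφ i) (hsub i hx) (hX' x))
    · have h0 : ContMDiffAt I (I.prod 𝓘(ℝ, E →L[ℝ] E)) ∞ (fun y : M ↦ (⟨y, 0⟩ :
        TotalSpace (E →L[ℝ] E) (fun p : M ↦ TangentSpace I p →L[ℝ] TangentSpace I p))) x :=
        (contMDiff_zeroSection ℝ (fun p : M ↦ TangentSpace I p →L[ℝ] TangentSpace I p)) x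
      refine h0.congr_of_eventuallyEq ?_
      filter_upwards [(isClosed_tsupport (ρ i)).isOpen_compl.mem_nhds hx] with y hy
      rw [image_eq_zero_of_notMem_tsupport hy, zero_smul]

theorem gluedConnection_preserves {J : EndField I M} (S : ι → E →L[ℝ] E)
    (hJ : ∀ i, ∀ y ∈ (φ i).source, ∀ v,
      chartDeriv I (φ i) y (J y v) = S i (chartDeriv I (φ i) y v)) :
    Preserves (gluedConnection hfin hsum hsub hφ) J := by
  intro Y hY x v
  obtain ⟨s, hs, -, h⟩ := gluedConnectionFun_exists_finset (I := I) hfin hsum hsub x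
  change gluedConnectionFun I ρ φ _ x v = J x (gluedConnectionFun I ρ φ Y x v)
  rw [h, h, sum_apply, sum_apply, map_sum]
  refine Finset.sum_congr rfl fun i hi ↦ ?_
  rw [smul_apply, smul_apply, map_smul,
    chartConnection_applyField (hφ i) (hs i hi) (hJ i) ((hY x).mdifferentiableAt (by simp))]

theorem gluedConnection_torsion [FiniteDimensional ℝ E] [CompleteSpace E] [I.Boundaryless] :
    (gluedConnection hfin hsum hsub hφ).torsion = 0 := by
  rw [CovariantDerivative.torsion_eq_zero_iff]
  intro X Y x hX hY
  obtain ⟨s, hs, h1, h⟩ := gluedConnectionFun_exists_finset (I := I) hfin hsum hsub x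
  change gluedConnectionFun I ρ φ Y x (X x) - gluedConnectionFun I ρ φ X x (Y x) = _
  rw [h, h, sum_apply, sum_apply, ← Finset.sum_sub_distrib,
    ← one_smul ℝ (mlieBracket I X Y x), ← h1, Finset.sum_smul]
  refine Finset.sum_congr rfl fun i hi ↦ ?_
  rw [smul_apply, smul_apply, ← smul_sub,
    chartConnection_torsion (hφ i) (hs i hi) hX hY]

/-- The Nijenhuis tensor of an involutive endomorphism field vanishes if there is a torsion-free
connection which preserves it. -/
theorem nijenhuis_eq_zero [FiniteDimensional ℝ E] [CompleteSpace E] {J : EndField I M}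
    (hJ : J.IsSmooth) (hsq : ∀ x v, J x (J x v) = v)
    (cov : CovariantDerivative I E (TangentSpace I : M → Type _)) (hpres : Preserves cov J)
    (htor : cov.torsion = 0) {Z W : VField I M} (hZ : Z.IsSmooth) (hW : W.IsSmooth) :
    nijenhuis J Z W = 0 := by
  rw [CovariantDerivative.torsion_eq_zero_iff] at htor
  have hJs : ∀ {X : VField I M}, X.IsSmooth → (J.applyField X).IsSmooth := fun hX x ↦
    (hJ x).clm_bundle_apply (hX x)
  have hd : ∀ {X : VField I M}, X.IsSmooth → ∀ x,
      MDifferentiableAt I I.tangent (fun y ↦ (⟨y, X y⟩ : TangentBundle I M)) x :=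
    fun hX x ↦ (hX x).mdifferentiableAt (by simp)
  funext x
  unfold nijenhuis
  rw [← htor (hd hZ x) (hd hW x), ← htor (hd (hJs hZ) x) (hd hW x),
    ← htor (hd hZ x) (hd (hJs hW) x), ← htor (hd (hJs hZ) x) (hd (hJs hW) x),
    hpres Z hZ, hpres W hW, hpres Z hZ, hpres W hW]
  simp only [map_sub, hsq]
  rw [Pi.zero_apply]
  abel

/-- An endomorphism field which is constant in a chart around every point is smooth. -/
theorem isSmooth_of_constant_in_charts [CompleteSpace E] {J : EndField I M}
    (hJ : ∀ x : M, ∃ φ ∈ IsManifold.maximalAtlas I ∞ M, x ∈ φ.source ∧ ∃ S : E →L[ℝ] E,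
      ∀ y ∈ φ.source, ∀ v, chartDeriv I φ y (J y v) = S (chartDeriv I φ y v)) :
    J.IsSmooth := by
  intro x
  obtain ⟨φ, hφ, hx, S, hS⟩ := hJ x
  have hA : ContMDiffAt I 𝓘(ℝ, E →L[ℝ] E) ∞ (fun y ↦ (S ∘L chartDeriv I φ y) ∘L
      (trivializationAt E (TangentSpace I : M → Type _) x).symmL ℝ y) x :=
    (contMDiffAt_const (c := S)).clm_comp (chartDeriv_symmL_contMDiffAt hφ hx)
  refine (contMDiffAt_chartDeriv_inverse_comp hφ hx hA).congr_of_eventuallyEq ?_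
  filter_upwards [φ.open_source.mem_nhds hx] with y hy
  congr 1
  ext v
  rw [← chartDeriv_inverse_apply_self hφ hy (J y v), hS y hy]
  rfl

end Glue

section LiftChart

variable {E : Type*} [NormedAddCommGroup E] [NormedSpace ℝ E]
  {H : Type*} [TopologicalSpace H] {I : ModelWithCorners ℝ E H}
  {M : Type*} [TopologicalSpace M] [ChartedSpace H M] [IsManifold I ∞ M]

theorem contMDiffOn_tangentMap {E' : Type*} [NormedAddCommGroup E'] [NormedSpace ℝ E']
    {H' : Type*} [TopologicalSpace H'] {I' : ModelWithCorners ℝ E' H'}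
    {M' : Type*} [TopologicalSpace M'] [ChartedSpace H' M'] [IsManifold I' ∞ M']
    {f : M → M'} {s : Set M} (hf : ContMDiffOn I I' ∞ f s) (hs : IsOpen s) :
    ContMDiffOn I.tangent I'.tangent ∞ (tangentMap I I' f)
      (TotalSpace.proj ⁻¹' s : Set (TangentBundle I M)) := by
  refine (hf.contMDiffOn_tangentMapWithin (m := ∞) (by simp) hs.uniqueMDiffOn).congr ?_
  intro q hq
  simp only [tangentMap, tangentMapWithin]
  rw [mfderivWithin_of_isOpen hs hq]

omit [IsManifold I ∞ M] in
theorem tangentMap_symm_tangentMap {E' : Type*} [NormedAddCommGroup E'] [NormedSpace ℝ E']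
    {H' : Type*} [TopologicalSpace H'] {I' : ModelWithCorners ℝ E' H'}
    {M' : Type*} [TopologicalSpace M'] [ChartedSpace H' M']
    {φ : OpenPartialHomeomorph M M'} (hφ : φ.MDifferentiable I I') {q : TangentBundle I M}
    (hq : q.proj ∈ φ.source) :
    tangentMap I' I φ.symm (tangentMap I I' φ q) = q :=
  TotalSpace.ext (φ.left_inv hq)
    (heq_of_eq (congrArg (fun T : E →L[ℝ] E ↦ T q.snd) (hφ.symm_comp_deriv hq)))

/-- The chart of the tangent bundle induced by a chart of the manifold. -/
def liftChart (φ : OpenPartialHomeomorph M H) (hφ : φ ∈ IsManifold.maximalAtlas I ∞ M) :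
    OpenPartialHomeomorph (TangentBundle I M) (ModelProd H E) where
  toFun q := tangentBundleModelSpaceHomeomorph I (tangentMap I I φ q)
  invFun z := tangentMap I I φ.symm ((tangentBundleModelSpaceHomeomorph I).symm z)
  source := TotalSpace.proj ⁻¹' φ.source
  target := Prod.fst ⁻¹' φ.target
  map_source' _ hq := φ.map_source hq
  map_target' _ hz := φ.map_target hz
  left_inv' q hq := by
    rw [Homeomorph.symm_apply_apply]
    exact tangentMap_symm_tangentMap (mdifferentiable_of_mem_maximalAtlas hφ) hq
  right_inv' z hz := by
    rw [← Homeomorph.eq_symm_apply]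
    exact tangentMap_symm_tangentMap (mdifferentiable_of_mem_maximalAtlas hφ).symm hz
  open_source := φ.open_source.preimage (FiberBundle.continuous_proj E (TangentSpace I))
  open_target := φ.open_target.preimage continuous_fst
  continuousOn_toFun := (tangentBundleModelSpaceHomeomorph I).continuous.comp_continuousOn
    (contMDiffOn_tangentMap (contMDiffOn_of_mem_maximalAtlas hφ) φ.open_source).continuousOn
  continuousOn_invFun :=
    (contMDiffOn_tangentMap (contMDiffOn_symm_of_mem_maximalAtlas hφ)
      φ.open_target).continuousOn.comp
    (tangentBundleModelSpaceHomeomorph I).symm.continuous.continuousOn (fun _ h ↦ h)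

variable {φ : OpenPartialHomeomorph M H} (hφ : φ ∈ IsManifold.maximalAtlas I ∞ M)

theorem liftChart_mem_maximalAtlas :
    liftChart φ hφ ∈ IsManifold.maximalAtlas I.tangent ∞ (TangentBundle I M) := by
  refine (liftChart φ hφ).mem_maximalAtlas_of_contMDiffOn ?_ ?_
  · exact contMDiff_tangentBundleModelSpaceHomeomorph.comp_contMDiffOn
      (contMDiffOn_tangentMap (contMDiffOn_of_mem_maximalAtlas hφ) φ.open_source)
  · exact (contMDiffOn_tangentMap (contMDiffOn_symm_of_mem_maximalAtlas hφ) φ.open_target).comp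
      contMDiff_tangentBundleModelSpaceHomeomorph_symm.contMDiffOn (fun _ h ↦ h)

theorem liftChart_extend_apply {q : TangentBundle I M} (hq : q.proj ∈ φ.source) :
    (liftChart φ hφ).extend I.tangent q = (φ.extend I q.proj, chartDeriv I φ q.proj q.snd) := by
  rw [chartDeriv_eq_mfderiv hφ hq]
  rfl

/-- The expression of a chart in the coordinates of the preferred chart at a point. -/
def transitionMap (I : ModelWithCorners ℝ E H) (φ : OpenPartialHomeomorph M H) (p : M) : E → E :=
  φ.extend I ∘ (extChartAt I p).symm

theorem contMDiffAt_extChartAt_symm_apply [I.Boundaryless] {p x : M}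
    (hx : x ∈ (chartAt H p).source) :
    ContMDiffAt 𝓘(ℝ, E) I ∞ (extChartAt I p).symm (extChartAt I p x) :=
  (contMDiffOn_extChartAt_symm p).contMDiffAt
    (extChartAt_target_mem_nhds' ((extChartAt I p).map_source (by simpa using hx)))

include hφ

theorem transitionMap_contDiffAt [I.Boundaryless] {p x : M} (hx : x ∈ φ.source)
    (hx' : x ∈ (chartAt H p).source) :
    ContDiffAt ℝ ∞ (transitionMap I φ p) (extChartAt I p x) := by
  rw [← contMDiffAt_iff_contDiffAt]
  refine ContMDiffAt.comp (I' := I) _ ?_ (contMDiffAt_extChartAt_symm_apply hx')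
  rw [(extChartAt I p).left_inv (by simpa using hx')]
  exact φ.contMDiffAt_extend hφ hx

theorem fderiv_transitionMap [I.Boundaryless] {p x : M} (hx : x ∈ φ.source)
    (hx' : x ∈ (chartAt H p).source) :
    fderiv ℝ (transitionMap I φ p) (extChartAt I p x) =
      chartDeriv I φ x ∘L (trivializationAt E (TangentSpace I : M → Type _) p).symmL ℝ x := by
  have h0 : (extChartAt I p).symm (extChartAt I p x) = x :=
    (extChartAt I p).left_inv (by simpa using hx')
  have h1 := ((contMDiffAt_extChartAt_symm_apply (I := I) hx').mdifferentiableAt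
    (by simp)).hasMFDerivAt
  have h2 : HasMFDerivAt I 𝓘(ℝ, E) (φ.extend I) ((extChartAt I p).symm (extChartAt I p x))
      (chartDeriv I φ x) := by
    rw [h0]
    exact ((φ.contMDiffAt_extend hφ hx).mdifferentiableAt (by simp)).hasMFDerivAt
  rw [TangentBundle.symmL_trivializationAt hx', I.range_eq_univ, mfderivWithin_univ,
    ← mfderiv_eq_fderiv]
  exact (h2.comp _ h1).mfderiv

/-- The induced chart of the tangent bundle, in the coordinates of the preferred chart at `q`. -/
theorem liftChart_extend_comp_extChartAt_symm [I.Boundaryless] (q : TangentBundle I M)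
    (hq : q.proj ∈ φ.source) :
    (liftChart φ hφ).extend I.tangent ∘ (extChartAt I.tangent q).symm
      =ᶠ[𝓝 (extChartAt I.tangent q q)] fun z : E × E ↦
        (transitionMap I φ q.proj z.1, fderiv ℝ (transitionMap I φ q.proj) z.1 z.2) := by
  have h0 : (extChartAt I.tangent q q).1 = extChartAt I q.proj q.proj := by
    rw [FiberBundle.extChartAt]
    simp
  have hev : ∀ᶠ u in 𝓝 (extChartAt I q.proj q.proj), u ∈ (extChartAt I q.proj).target ∧
      (extChartAt I q.proj).symm u ∈ φ.source := by
    refine Eventually.and (extChartAt_target_mem_nhds q.proj)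
      ((continuousAt_extChartAt_symm q.proj).preimage_mem_nhds (φ.open_source.mem_nhds ?_))
    simpa only [extChartAt_to_inv] using hq
  rw [← h0] at hev
  filter_upwards [continuous_fst.continuousAt.eventually hev] with z hz
  obtain ⟨u, w⟩ := z
  obtain ⟨hu, hu'⟩ := hz
  set y := (extChartAt I q.proj).symm u with hy
  have hy' : y ∈ (chartAt H q.proj).source := by
    have := (extChartAt I q.proj).map_target hu
    rwa [extChartAt_source] at this
  have hyu : extChartAt I q.proj y = u := (extChartAt I q.proj).right_inv hu
  have h1 : (extChartAt I.tangent q).symm (u, w) =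
      (⟨y, (trivializationAt E (TangentSpace I : M → Type _) q.proj).symmL ℝ y w⟩ :
        TangentBundle I M) := by
    rw [FiberBundle.extChartAt, Trivialization.symmL_apply]
    exact ((trivializationAt E (TangentSpace I : M → Type _) q.proj).mk_symm hy' w).symm
    exact hy'
  rw [Function.comp_apply, h1, liftChart_extend_apply hφ hu']
  simp only
  rw [← hyu, fderiv_transitionMap hφ hu' hy', hyu]
  rfl

end LiftChart

section KeyFormula

variable {E : Type*} [NormedAddCommGroup E] [NormedSpace ℝ E]

/-- The tangent map `(x, v) ↦ (τ x, dτ_x v)` intertwines the coordinate expression of the complete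
lift of `j` with `S × S` as soon as `τ` intertwines `j` and the constant `S`. -/
theorem fderiv_tangent_completeLift {τ : E → E} {x : E} (hτ : ContDiffAt ℝ ∞ τ x)
    {j : E → E →L[ℝ] E} (hj : DifferentiableAt ℝ j x) {S : E →L[ℝ] E}
    (h : ∀ᶠ u in 𝓝 x, fderiv ℝ τ u ∘L j u = S ∘L fderiv ℝ τ u) (v a b : E) :
    fderiv ℝ (fun z : E × E ↦ (τ z.1, fderiv ℝ τ z.1 z.2)) (x, v)
        (j x a, fderiv ℝ j x v a + j x b) =
      S.prodMap S (fderiv ℝ (fun z : E × E ↦ (τ z.1, fderiv ℝ τ z.1 z.2)) (x, v) (a, b)) := by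
  have hτ1 : HasFDerivAt τ (fderiv ℝ τ x) x := (hτ.differentiableAt (by simp)).hasFDerivAt
  have hτ2 : HasFDerivAt (fderiv ℝ τ) (fderiv ℝ (fderiv ℝ τ) x) x :=
    ((hτ.fderiv_right (m := ∞) (by simp)).differentiableAt (by simp)).hasFDerivAt
  have hsymm : ∀ a b, fderiv ℝ (fderiv ℝ τ) x a b = fderiv ℝ (fderiv ℝ τ) x b a := fun a b ↦
    hτ.isSymmSndFDerivAt (by rw [minSmoothness_of_isRCLikeNormedField]; exact ENat.LEInfty.out) a b
  have hT : ∀ a b, fderiv ℝ (fun z : E × E ↦ (τ z.1, fderiv ℝ τ z.1 z.2)) (x, v) (a, b) =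
      (fderiv ℝ τ x a, fderiv ℝ (fderiv ℝ τ) x a v + fderiv ℝ τ x b) := by
    intro a b
    have h1 : HasFDerivAt (fun z : E × E ↦ τ z.1) _ (x, v) := hτ1.comp (x, v) hasFDerivAt_fst
    have h2 : HasFDerivAt (fun z : E × E ↦ fderiv ℝ τ z.1) _ (x, v) :=
      hτ2.comp (x, v) hasFDerivAt_fst
    rw [(h1.prodMk (h2.clm_apply hasFDerivAt_snd)).fderiv]
    simp [add_comm]
  have h0 : fderiv ℝ τ x ∘L j x = S ∘L fderiv ℝ τ x := h.self_of_nhds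
  have h1 : fderiv ℝ (fderiv ℝ τ) x v (j x a) + fderiv ℝ τ x (fderiv ℝ j x v a) =
      S (fderiv ℝ (fderiv ℝ τ) x v a) := by
    have hl := hτ2.clm_comp hj.hasFDerivAt
    have hr := (hasFDerivAt_const S x).clm_comp hτ2
    have := (hl.congr_of_eventuallyEq (h.mono fun u hu ↦ hu.symm)).unique hr
    have := congrArg (fun T ↦ T v a) this
    simpa [add_comm] using this
  have h0' : ∀ c, fderiv ℝ τ x (j x c) = S (fderiv ℝ τ x c) := fun c ↦
    congrArg (fun T : E →L[ℝ] E ↦ T c) h0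
  rw [hT, hT]
  refine Prod.ext (h0' a) ?_
  change fderiv ℝ (fderiv ℝ τ) x (j x a) v + fderiv ℝ τ x (fderiv ℝ j x v a + j x b) =
    S (fderiv ℝ (fderiv ℝ τ) x a v + fderiv ℝ τ x b)
  rw [map_add, map_add, hsymm (j x a) v, hsymm a v, h0', ← h1, add_assoc]

variable {H : Type*} [TopologicalSpace H] {I : ModelWithCorners ℝ E H}
  {M : Type*} [TopologicalSpace M] [ChartedSpace H M]

theorem mfderiv_eq_fderiv_comp_extChartAt_symm [I.Boundaryless] {F : Type*} [NormedAddCommGroup F]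
    [NormedSpace ℝ F] {f : M → F} {x : M} (hf : MDifferentiableAt I 𝓘(ℝ, F) f x) :
    mfderiv I 𝓘(ℝ, F) f x = fderiv ℝ (f ∘ (extChartAt I x).symm) (extChartAt I x x) := by
  refine (if_pos hf).trans ?_
  rw [I.range_eq_univ, fderivWithin_univ]
  rfl

variable [IsManifold I ∞ M]

theorem extChartAt_tangentBundle_self (q : TangentBundle I M) :
    extChartAt I.tangent q q = ((extChartAt I q.proj q.proj, q.snd) : E × E) := by
  rw [FiberBundle.extChartAt]
  refine Prod.ext ?_ ?_
  · simp
  · exact (tangentBundleCore I M).coordChange_self _ _ (mem_chart_source H q.proj) _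

theorem EndField.coord_mdifferentiableAt {J : EndField I M} (hJ : J.IsSmooth) (p : M) :
    MDifferentiableAt I 𝓘(ℝ, E →L[ℝ] E) (J.coord p) p :=
  ((mdifferentiableAt_hom_bundle _).1 ((hJ p).mdifferentiableAt (by simp))).2

/-- If `J` has the constant matrix `S` in a chart, then its complete lift has the constant matrix
`S × S` in the induced chart of the tangent bundle. -/
theorem chartDeriv_liftChart_completeLift [I.Boundaryless] {φ : OpenPartialHomeomorph M H}
    (hφ : φ ∈ IsManifold.maximalAtlas I ∞ M) {J : EndField I M} (hJ : J.IsSmooth) {S : E →L[ℝ] E}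
    (hS : ∀ y ∈ φ.source, ∀ v, chartDeriv I φ y (J y v) = S (chartDeriv I φ y v))
    (q : TangentBundle I M) (hq : q ∈ (liftChart φ hφ).source) (w : TangentSpace I.tangent q) :
    chartDeriv I.tangent (liftChart φ hφ) q (J.completeLift q w) =
      S.prodMap S (chartDeriv I.tangent (liftChart φ hφ) q w) := by
  have hq' : q.proj ∈ φ.source := hq
  set p := q.proj with hp
  have hpc := mem_chart_source H p
  set x₀ := extChartAt I p p with hx₀
  set j : E → E →L[ℝ] E := J.coord p ∘ (extChartAt I p).symm with hj
  have hJp := EndField.coord_mdifferentiableAt hJ p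
  have hjd : DifferentiableAt ℝ j x₀ := by
    rw [← mdifferentiableAt_iff_differentiableAt]
    refine MDifferentiableAt.comp (I' := I) _ ?_
      ((contMDiffAt_extChartAt_symm_apply hpc).mdifferentiableAt (by simp))
    rwa [extChartAt_to_inv]
  have hjx : j x₀ = J p := by
    rw [← J.coord_self p]
    simp [hj, hx₀]
  have hev : ∀ᶠ u in 𝓝 x₀, fderiv ℝ (transitionMap I φ p) u ∘L j u =
      S ∘L fderiv ℝ (transitionMap I φ p) u := by
    have h1 : ∀ᶠ u in 𝓝 x₀, (extChartAt I p).symm u ∈ φ.source :=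
      (continuousAt_extChartAt_symm p).preimage_mem_nhds
        (φ.open_source.mem_nhds (by simpa only [extChartAt_to_inv] using hq'))
    filter_upwards [h1, extChartAt_target_mem_nhds p] with u hu hu'
    have hy' : (extChartAt I p).symm u ∈ (chartAt H p).source := by
      have := (extChartAt I p).map_target hu'
      rwa [extChartAt_source] at this
    have hyu := (extChartAt I p).right_inv hu'
    have hD := fderiv_transitionMap hφ hu hy'
    rw [hyu] at hD
    rw [hD]
    ext c
    have hb : (extChartAt I p).symm u ∈
        (trivializationAt E (TangentSpace I : M → Type _) p).baseSet := hy'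
    simp only [hj, ContinuousLinearMap.comp_apply, Function.comp_apply, EndField.coord,
      ContinuousLinearMap.inCoordinates]
    rw [Trivialization.symmL_continuousLinearMapAt _ hb, hS _ hu]
  have hmd : MDifferentiableAt I.tangent 𝓘(ℝ, E × E) ((liftChart φ hφ).extend I.tangent) q :=
    ((liftChart φ hφ).contMDiffAt_extend (liftChart_mem_maximalAtlas hφ) hq).mdifferentiableAt
      (by simp)
  have hD : chartDeriv I.tangent (liftChart φ hφ) q =
      fderiv ℝ (fun z : E × E ↦ (transitionMap I φ p z.1, fderiv ℝ (transitionMap I φ p) z.1 z.2))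
        (x₀, q.snd) := by
    unfold chartDeriv
    rw [mfderiv_eq_fderiv_comp_extChartAt_symm hmd,
      (liftChart_extend_comp_extChartAt_symm hφ q hq').fderiv_eq,
      extChartAt_tangentBundle_self]
  have hB : mfderiv I 𝓘(ℝ, E →L[ℝ] E) (J.coord p) p = fderiv ℝ j x₀ :=
    mfderiv_eq_fderiv_comp_extChartAt_symm hJp
  have key := fderiv_tangent_completeLift (transitionMap_contDiffAt hφ hq' hpc) hjd hev q.snd
    w.1 w.2
  rw [hD]
  refine Eq.trans ?_ key
  congr 1
  rw [hjx, ← hB]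
  rfl

end KeyFormula

section Paracomplex

/-- The linear map on the model space which exchanges the two halves of the coordinates. -/
def swapVia {E : Type*} [NormedAddCommGroup E] [NormedSpace ℝ E] {m : ℕ}
    (L : E ≃L[ℝ] (Fin m → ℝ) × (Fin m → ℝ)) : E →L[ℝ] E :=
  (L.trans ((ContinuousLinearEquiv.prodComm ℝ (Fin m → ℝ) (Fin m → ℝ)).trans L.symm) : E ≃L[ℝ] E)

theorem apply_swapVia {E : Type*} [NormedAddCommGroup E] [NormedSpace ℝ E] {m : ℕ}
    (L : E ≃L[ℝ] (Fin m → ℝ) × (Fin m → ℝ)) (v : E) : L (swapVia L v) = (L v).swap := by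
  simp [swapVia]

/-- An endomorphism which is conjugate to the exchange of the two factors of `V × V` has
eigenspaces of the same dimension for the eigenvalues `1` and `-1`. -/
theorem finrank_eigenspace_eq_of_conj_swap {V W : Type*} [AddCommGroup V] [Module ℝ V]
    [AddCommGroup W] [Module ℝ W] (f : Module.End ℝ V) (e : V ≃ₗ[ℝ] W × W)
    (h : ∀ v, e (f v) = (e v).swap) :
    Module.finrank ℝ (f.eigenspace 1) = Module.finrank ℝ (f.eigenspace (-1)) := by
  let k : V ≃ₗ[ℝ] V := e.trans (((LinearEquiv.refl ℝ W).prodCongr (LinearEquiv.neg ℝ)).trans e.symm)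
  have hek : ∀ v, e (k v) = ((e v).1, -(e v).2) := fun v ↦ by simp [k]
  have hkf : ∀ v, f (k v) = -k (f v) := fun v ↦ e.injective (by
    rw [h, hek, map_neg, hek, h]
    simp)
  have hmap : (f.eigenspace 1).map (k : V →ₗ[ℝ] V) = f.eigenspace (-1) := by
    ext v
    rw [Submodule.mem_map_equiv, Module.End.mem_eigenspace_iff, Module.End.mem_eigenspace_iff,
      one_smul, neg_one_smul]
    obtain ⟨u, rfl⟩ := k.surjective v
    rw [LinearEquiv.symm_apply_apply, hkf, neg_inj, k.injective.eq_iff]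
  rw [← hmap]
  exact (k.submoduleMap (f.eigenspace 1)).finrank_eq

/-- The coordinates `(x, x', y, y')` on `E × E`, regrouped as `((x, x'), (y, y'))`. -/
def doubleCoords {E : Type*} [NormedAddCommGroup E] [NormedSpace ℝ E] {m : ℕ}
    (L : E ≃L[ℝ] (Fin m → ℝ) × (Fin m → ℝ)) :
    (E × E) ≃L[ℝ] (Fin (m + m) → ℝ) × (Fin (m + m) → ℝ) :=
  let c : ((Fin m → ℝ) × (Fin m → ℝ)) ≃L[ℝ] (Fin (m + m) → ℝ) :=
    ContinuousLinearEquiv.ofFinrankEq (by simp)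
  (L.prodCongr L).trans
    ((ContinuousLinearEquiv.prodProdProdComm ℝ _ _ _ _).trans (c.prodCongr c))

theorem doubleCoords_swapVia {E : Type*} [NormedAddCommGroup E] [NormedSpace ℝ E] {m : ℕ}
    (L : E ≃L[ℝ] (Fin m → ℝ) × (Fin m → ℝ)) (w : E × E) :
    doubleCoords L ((swapVia L).prodMap (swapVia L) w) = (doubleCoords L w).swap := by
  obtain ⟨u, v⟩ := w
  simp [doubleCoords, apply_swapVia, ContinuousLinearEquiv.prodProdProdComm]

variable {E : Type*} [NormedAddCommGroup E] [NormedSpace ℝ E]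
  {H : Type*} [TopologicalSpace H] {I : ModelWithCorners ℝ E H}
  {M : Type*} [TopologicalSpace M] [ChartedSpace H M] [IsManifold I ∞ M]

/-- An endomorphism field which exchanges the two halves of the coordinates in some chart around
every point is a paracomplex structure. -/
theorem isParacomplex_of_charts [CompleteSpace E] {J : EndField I M}
    (hJ : ∀ p : M, ∃ φ ∈ IsManifold.maximalAtlas I ∞ M, p ∈ φ.source ∧
      ∃ (m : ℕ) (L : E ≃L[ℝ] (Fin m → ℝ) × (Fin m → ℝ)),
        ∀ y ∈ φ.source, ∀ v, L (chartDeriv I φ y (J y v)) = (L (chartDeriv I φ y v)).swap) :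
    IsParacomplex J where
  smooth := isSmooth_of_constant_in_charts fun x ↦ by
    obtain ⟨φ, hφ, hx, m, L, hL⟩ := hJ x
    refine ⟨φ, hφ, hx, swapVia L, fun y hy v ↦ L.injective ?_⟩
    rw [hL y hy, apply_swapVia]
  sq p v := by
    obtain ⟨φ, hφ, hp, m, L, hL⟩ := hJ p
    obtain ⟨e, he⟩ := chartDeriv_exists_equiv hφ hp
    have := hL p hp
    rw [he] at this
    refine e.injective (L.injective ?_)
    exact ((this _).trans (congrArg Prod.swap (this v))).trans (Prod.swap_swap _)
  rank_eq p := by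
    obtain ⟨φ, hφ, hp, m, L, hL⟩ := hJ p
    obtain ⟨e, he⟩ := chartDeriv_exists_equiv hφ hp
    have := hL p hp
    rw [he] at this
    exact finrank_eigenspace_eq_of_conj_swap _ (e.trans L).toLinearEquiv this
  integrable := hJ

/-- The complete lift of a paracomplex structure is a paracomplex structure. -/
theorem IsParacomplex.completeLift [CompleteSpace E] [I.Boundaryless] {J : EndField I M}
    (hJ : IsParacomplex J) : IsParacomplex J.completeLift := by
  refine isParacomplex_of_charts fun q ↦ ?_
  obtain ⟨φ, hφ, hq, m, L, hL⟩ := hJ.integrable q.proj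
  refine ⟨liftChart φ hφ, liftChart_mem_maximalAtlas hφ, hq, m + m, doubleCoords L,
    fun y hy v ↦ ?_⟩
  rw [chartDeriv_liftChart_completeLift hφ hJ.smooth (S := swapVia L)
    (fun y hy v ↦ L.injective ((hL y hy v).trans (apply_swapVia L _).symm)) y hy v]
  exact doubleCoords_swapVia L _

/-- There is a smooth torsion-free connection on the tangent bundle of `M` which preserves the
complete lift of a given paracomplex structure. -/
theorem IsParacomplex.exists_connection_completeLift [FiniteDimensional ℝ E] [CompleteSpace E]
    [T2Space M] [SigmaCompactSpace M] [I.Boundaryless] {J : EndField I M} (hJ : IsParacomplex J) :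
    ∃ cov : CovariantDerivative I.tangent (E × E)
        (TangentSpace I.tangent : TangentBundle I M → Type _),
      CovariantDerivative.ContMDiffCovariantDerivative cov ∞ ∧
      Preserves cov J.completeLift ∧ cov.torsion = 0 := by
  choose φ hφ hp m L hL using hJ.integrable
  obtain ⟨f, hf⟩ := SmoothPartitionOfUnity.exists_isSubordinate I isClosed_univ
    (fun p ↦ (φ p).source) (fun p ↦ (φ p).open_source)
    (fun p _ ↦ Set.mem_iUnion.2 ⟨p, hp p⟩)
  have hπ : Continuous (TotalSpace.proj : TangentBundle I M → M) :=
    FiberBundle.continuous_proj E (TangentSpace I)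
  have hfin : LocallyFinite fun i ↦ Function.support
      fun q : TangentBundle I M ↦ f i q.proj := f.locallyFinite.preimage_continuous hπ
  have hsum : ∀ q : TangentBundle I M, ∑ᶠ i, f i q.proj = 1 := fun q ↦
    f.sum_eq_one (Set.mem_univ q.proj)
  have hsub : ∀ i, tsupport (fun q : TangentBundle I M ↦ f i q.proj) ⊆
      (liftChart (φ i) (hφ i)).source := fun i ↦
    (tsupport_comp_subset_preimage (f i) hπ).trans (Set.preimage_mono (hf i))
  refine ⟨gluedConnection hfin hsum hsub fun i ↦ liftChart_mem_maximalAtlas (hφ i), ?_, ?_, ?_⟩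
  · exact gluedConnection_contMDiff _ _ _ _ fun i ↦
      (f i).contMDiff.comp (contMDiff_proj (TangentSpace I))
  · exact gluedConnection_preserves _ _ _ _ (fun i ↦ (swapVia (L i)).prodMap (swapVia (L i)))
      fun i ↦ chartDeriv_liftChart_completeLift (hφ i) hJ.smooth
        fun y hy v ↦ (L i).injective ((hL i y hy v).trans (apply_swapVia (L i) _).symm)
  · exact gluedConnection_torsion _ _ _ _

end Paracomplex

end ParaLift

end

theorem mainTheorem2 (m : ℕ) (M : Type*) [TopologicalSpace M] [T2Space M]
    [SecondCountableTopology M] [ChartedSpace (EuclideanSpace ℝ (Fin (2 * m))) M]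
    [IsManifold (𝓡 (2 * m)) ∞ M]
    (J : EndField (𝓡 (2 * m)) M) (hJ : IsParacomplex J) :
    IsParacomplex J.completeLift ∧
    (∀ Z W : VField (𝓡 (2 * m)).tangent (TangentBundle (𝓡 (2 * m)) M),
      Z.IsSmooth → W.IsSmooth → nijenhuis J.completeLift Z W = 0) ∧
    ∃ cov : CovariantDerivative (𝓡 (2 * m)).tangent
        (EuclideanSpace ℝ (Fin (2 * m)) × EuclideanSpace ℝ (Fin (2 * m)))
        (TangentSpace (𝓡 (2 * m)).tangent : TangentBundle (𝓡 (2 * m)) M → Type _),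
      CovariantDerivative.ContMDiffCovariantDerivative cov ∞ ∧
      Preserves cov J.completeLift ∧
      cov.torsion = 0 := by
  have : LocallyCompactSpace M :=
    ChartedSpace.locallyCompactSpace (EuclideanSpace ℝ (Fin (2 * m))) M
  have hlift := hJ.completeLift
  obtain ⟨cov, hsmooth, hpres, htor⟩ := hJ.exists_connection_completeLift
  exact ⟨hlift, fun Z W hZ hW ↦ nijenhuis_eq_zero hlift.smooth hlift.sq cov hpres htor hZ hW,
    cov, hsmooth, hpres, htor⟩
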